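/- Let $n\ge 1$, let $\mathfrak{sl}_n$ be the complex Lie algebra of trace zero $n\times n$ matrices, and let $\mathfrak{sl}_n=\mathfrak n_+\oplus\mathfrak h\oplus\mathfrak n_-$, where $\mathfrak n_+$, $\mathfrak h$, $\mathfrak n_-$ are the strictly upper triangular, the diagonal and the strictly lower triangular matrices in $\mathfrak{sl}_n$. Let $\varepsilon_i\in\mathfrak h^*$ be the $i$-th diagonal entry, $\rho=\frac12\sum_{1\le i<j\le n}(\varepsilon_i-\varepsilon_j)\in\mathfrak h^*$, $h_i=E_{ii}-E_{i+1,i+1}$ for $1\le i\le n-1$, and $P_n^+=\{\mu\in\mathfrak h^*\mid \mu(h_i)\in\mathbb Z_{\ge 0}\text{ for } 1\le i\le n-1\}$. For an $\mathfrak h$-module $Y$ and $\mu\in\mathfrak h^*$ put $Y_\mu=\{v\in Y\mid hv=\mu(h)v\ \forall h\in\mathfrak h\}$. Let $\mathcal O(\mathfrak{sl}_n)$ be the category of $\mathfrak{sl}_n$-modules $X$ such that $X$ is finitely generated over the enveloping algebra $U(\mathfrak{sl}_n)$, $\dim_{\mathbb C} U(\mathfrak n_+)v<\infty$ for every $v\in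 X$, and $X=\bigoplus_{\mu\in\mathfrak h^*}X_\mu$. For $\lambda\in\mathfrak h^*$ let $M(\lambda)$ be the Verma module with highest weight $\lambda$, i.e. the quotient of $U(\mathfrak{sl}_n)$ by the left ideal generated by $\mathfrak n_+$ and all $h-\lambda(h)$, $h\in\mathfrak h$. Let $\chi_\lambda$ be the infinitesimal character of $M(\lambda)$, i.e. the character of the center $Z$ of $U(\mathfrak{sl}_n)$ with $zv=\chi_\lambda(z)v$ for $z\in Z$, $v\in M(\lambda)$; its kernel $Z_\lambda$ is the ideal of all $z\in Z$ that act by zero on $M(\lambda)$. For $X\in\mathcal O(\mathfrak{sl}_n)$ let $$X^{[\lambda]}=\{v\in X\mid (Z_\lambda)^k v=0\text{ for some }k\ge 0\},$$ the block component of $X$ with generalized infinitesimal character $\chi_\lambda$; it is an $\mathfrak{sl}_n$-submodule of $X$. Let $H_0(\mathfrak n_-,X)=X/\mathfrak n_-X$ with the induced action of $\mathfrak h$. **Proposition.** If $\lambda\in\mathfrak h^*$ and $\lambda+\rho\in P_n^+$, then for every $X\in\mathcal O(\mathfrak{sl}_n)$ the natural linear map $$(X^{[\lambda]})_\lambda\longrightarrow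 H_0(\mathfrak n_-,X)_\lambda,\qquad v\mapsto v+\mathfrak n_-X,$$ is bijective. -/

import Mathlib

attribute [local instance 100] LieRing.ofAssociativeRing

noncomputable section

namespace CategoryO

/-- The complex Lie algebra of trace zero `n × n` matrices. -/
abbrev SL (n : ℕ) : Type := LieAlgebra.SpecialLinear.sl (Fin n) ℂ

/-- The Cartan subalgebra `𝔥` of diagonal matrices. -/
def cartan (n : ℕ) : LieSubalgebra ℂ (SL n) where
  carrier := {A | ∀ i j, i ≠ j → A.val i j = 0}
  zero_mem' := by intro i j _; rfl
  add_mem' := by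
    intro A B hA hB i j hij
    simp [hA i j hij, hB i j hij]
  smul_mem' := by
    intro c A hA i j hij
    simp [hA i j hij]
  lie_mem' := by
    intro A B hA hB i j hij
    rw [LieAlgebra.SpecialLinear.sl_bracket, Matrix.sub_apply, Matrix.mul_apply, Matrix.mul_apply,
      Finset.sum_eq_zero, Finset.sum_eq_zero, sub_zero]
    · intro k _
      by_cases h : i = k
      · subst h; rw [hA i j hij, mul_zero]
      · rw [hB i k h, zero_mul]
    · intro k _
      by_cases h : i = k
      · subst h; rw [hB i j hij, mul_zero]
      · rw [hA i k h, zero_mul]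

/-- The sum `𝔫₊` of the positive root spaces: strictly upper triangular matrices. -/
def nPlus (n : ℕ) : LieSubalgebra ℂ (SL n) where
  carrier := {A | ∀ i j, j ≤ i → A.val i j = 0}
  zero_mem' := by intro i j _; rfl
  add_mem' := by
    intro A B hA hB i j hij
    simp [hA i j hij, hB i j hij]
  smul_mem' := by
    intro c A hA i j hij
    simp [hA i j hij]
  lie_mem' := by
    intro A B hA hB i j hij
    rw [LieAlgebra.SpecialLinear.sl_bracket, Matrix.sub_apply, Matrix.mul_apply, Matrix.mul_apply,
      Finset.sum_eq_zero, Finset.sum_eq_zero, sub_zero]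
    · intro k _
      rcases le_or_gt k i with h | h
      · rw [hB i k h, zero_mul]
      · rw [hA k j (hij.trans h.le), mul_zero]
    · intro k _
      rcases le_or_gt k i with h | h
      · rw [hA i k h, zero_mul]
      · rw [hB k j (hij.trans h.le), mul_zero]

/-- The sum `𝔫₋` of the negative root spaces: strictly lower triangular matrices. -/
def nMinus (n : ℕ) : LieSubalgebra ℂ (SL n) where
  carrier := {A | ∀ i j, i ≤ j → A.val i j = 0}
  zero_mem' := by intro i j _; rfl
  add_mem' := by
    intro A B hA hB i j hij
    simp [hA i j hij, hB i j hij]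
  smul_mem' := by
    intro c A hA i j hij
    simp [hA i j hij]
  lie_mem' := by
    intro A B hA hB i j hij
    rw [LieAlgebra.SpecialLinear.sl_bracket, Matrix.sub_apply, Matrix.mul_apply, Matrix.mul_apply,
      Finset.sum_eq_zero, Finset.sum_eq_zero, sub_zero]
    · intro k _
      rcases le_or_gt i k with h | h
      · rw [hB i k h, zero_mul]
      · rw [hA k j (h.le.trans hij), mul_zero]
    · intro k _
      rcases le_or_gt i k with h | h
      · rw [hA i k h, zero_mul]
      · rw [hB k j (h.le.trans hij), mul_zero]

theorem lie_cartan_nMinus {n : ℕ} (h : cartan n) (y : nMinus n) :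
    ⁅(h : SL n), (y : SL n)⁆ ∈ nMinus n := by
  intro i j hij
  rw [LieAlgebra.SpecialLinear.sl_bracket, Matrix.sub_apply, Matrix.mul_apply, Matrix.mul_apply,
    Finset.sum_eq_zero, Finset.sum_eq_zero, sub_zero]
  · intro k _
    by_cases hk : k = j
    · subst hk; rw [y.2 i k hij, zero_mul]
    · rw [h.2 k j hk, mul_zero]
  · intro k _
    by_cases hk : i = k
    · subst hk; rw [y.2 i j hij, mul_zero]
    · rw [h.2 i k hk, zero_mul]

/-- Weights: elements of `𝔥*`. -/
abbrev Weight (n : ℕ) : Type := Module.Dual ℂ (cartan n)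

/-- The coordinate functional `εᵢ` restricted to `𝔥`: the `i`-th diagonal entry. -/
def eps {n : ℕ} (i : Fin n) : Weight n where
  toFun h := (h : SL n).val i i
  map_add' _ _ := rfl
  map_smul' _ _ := rfl

/-- `ρ`, half the sum of the positive roots `εᵢ - εⱼ`, `i < j`. -/
def rho (n : ℕ) : Weight n :=
  (1 / 2 : ℂ) • ∑ p : Fin n × Fin n with p.1 < p.2, (eps p.1 - eps p.2)

/-- The simple coroot `hᵢ = Eᵢᵢ - Eⱼⱼ`, `j = i + 1` (indices start at `0`). -/
def simpleCoroot {n : ℕ} (i : ℕ) (hi : i + 1 < n) : cartan n :=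
  ⟨LieAlgebra.SpecialLinear.singleSubSingle ⟨i, Nat.lt_of_succ_lt hi⟩ ⟨i + 1, hi⟩ 1, by
    intro a b hab
    simp only [LieAlgebra.SpecialLinear.val_singleSubSingle, Matrix.sub_apply]
    rw [Matrix.single_apply, Matrix.single_apply, if_neg, if_neg, sub_zero]
    · rintro ⟨rfl, h⟩; exact hab h
    · rintro ⟨rfl, h⟩; exact hab h⟩

/-- `wt ∈ P⁺`: every `⟨wt, hᵢ⟩` is a non-negative integer. -/
def IsDominantIntegral {n : ℕ} (wt : Weight n) : Prop :=
  ∀ (i : ℕ) (hi : i + 1 < n), ∃ m : ℕ, wt (simpleCoroot i hi) = (m : ℂ)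

section Action

variable (L : Type*) [LieRing L] [LieAlgebra ℂ L]
  (X : Type*) [AddCommGroup X] [Module ℂ X] [LieRingModule L X] [LieModule ℂ L X]

/-- The action of the universal enveloping algebra `U(L)` on an `L`-module. -/
def envAction : UniversalEnvelopingAlgebra ℂ L →ₐ[ℂ] Module.End ℂ X :=
  UniversalEnvelopingAlgebra.lift ℂ (LieModule.toEnd ℂ L X)

/-- An `L`-module viewed as a `U(L)`-module. -/
abbrev envModule : Module (UniversalEnvelopingAlgebra ℂ L) X :=
  Module.compHom X (envAction L X).toRingHom

end Action

section Modules

variable {n : ℕ} (X : Type*) [AddCommGroup X] [Module ℂ X]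
  [LieRingModule (SL n) X] [LieModule ℂ (SL n) X]

/-- The weight space `X_wt` of an `𝔥`-module. -/
def weightSpace (X : Type*) [AddCommGroup X] [Module ℂ X]
    [LieRingModule (cartan n) X] [LieModule ℂ (cartan n) X] (wt : Weight n) : Submodule ℂ X :=
  (LieModule.weightSpace X (wt : cartan n → ℂ)).toSubmodule

theorem mem_weightSpace {X : Type*} [AddCommGroup X] [Module ℂ X]
    [LieRingModule (cartan n) X] [LieModule ℂ (cartan n) X] {wt : Weight n} {v : X} :
    v ∈ weightSpace X wt ↔ ∀ h : cartan n, ⁅h, v⁆ = wt h • v :=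
  LieModule.mem_weightSpace _ v

open Classical in
/-- The objects of the category `𝒪(𝔰𝔩ₙ)`. -/
structure IsObject (n : ℕ) (X : Type*) [AddCommGroup X] [Module ℂ X]
    [LieRingModule (SL n) X] [LieModule ℂ (SL n) X] : Prop where
  /-- `X` is finitely generated over `U(𝔰𝔩ₙ)`. -/
  finite : @Module.Finite (UniversalEnvelopingAlgebra ℂ (SL n)) X _ _ (envModule (SL n) X)
  /-- `U(𝔫₊) v` is finite-dimensional for every `v`. -/
  locallyFinite : ∀ v : X, FiniteDimensional ℂ
    (LinearMap.range ((LinearMap.applyₗ v).comp (envAction (nPlus n) X).toLinearMap))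
  /-- `X` is the direct sum of its weight spaces. -/
  weightDecomposition : DirectSum.IsInternal fun wt : Weight n => weightSpace X wt

/-- The left ideal of `U(𝔰𝔩ₙ)` generated by `𝔫₊` and by `h - wt(h)`, `h ∈ 𝔥`. -/
def vermaIdeal (wt : Weight n) :
    Submodule (UniversalEnvelopingAlgebra ℂ (SL n)) (UniversalEnvelopingAlgebra ℂ (SL n)) :=
  Submodule.span _
    (Set.range (fun e : nPlus n => UniversalEnvelopingAlgebra.ι ℂ (e : SL n)) ∪
      Set.range (fun h : cartan n => UniversalEnvelopingAlgebra.ι ℂ (h : SL n) -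
        algebraMap ℂ (UniversalEnvelopingAlgebra ℂ (SL n)) (wt h)))

/-- The Verma module `M(wt)` with highest weight `wt`. -/
abbrev Verma (wt : Weight n) : Type :=
  UniversalEnvelopingAlgebra ℂ (SL n) ⧸ vermaIdeal wt

/-- The center `Z(U(𝔰𝔩ₙ))`. -/
abbrev Center (n : ℕ) : Subalgebra ℂ (UniversalEnvelopingAlgebra ℂ (SL n)) :=
  Subalgebra.center ℂ (UniversalEnvelopingAlgebra ℂ (SL n))

/-- The ideal `Z_wt = Ker χ_wt` of the center. As `z` acts on the non-zero module `M(wt)` by the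
scalar `χ_wt(z)`, the kernel of `χ_wt` consists of the `z` that act by zero on `M(wt)`. -/
def infCharKer (wt : Weight n) : Ideal (Center n) :=
  Module.annihilator (Center n) (Verma wt)

/-- The component `X^[wt]`: the vectors killed by some power of `Z_wt`. -/
def block (wt : Weight n) : LieSubmodule ℂ (SL n) X where
  carrier := {v | ∃ k : ℕ, ∀ z ∈ infCharKer wt ^ k,
    envAction (SL n) X (z : UniversalEnvelopingAlgebra ℂ (SL n)) v = 0}
  zero_mem' := ⟨0, fun z _ => map_zero _⟩
  add_mem' := by
    rintro v w ⟨k, hk⟩ ⟨l, hl⟩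
    refine ⟨max k l, fun z hz => ?_⟩
    rw [map_add, hk z (Ideal.pow_le_pow_right (le_max_left k l) hz),
      hl z (Ideal.pow_le_pow_right (le_max_right k l) hz), add_zero]
  smul_mem' := by
    rintro c v ⟨k, hk⟩
    exact ⟨k, fun z hz => by rw [map_smul, hk z hz, smul_zero]⟩
  lie_mem := by
    rintro x v ⟨k, hk⟩
    refine ⟨k, fun z hz => ?_⟩
    have hx : ∀ w : X, ⁅x, w⁆ = envAction (SL n) X (UniversalEnvelopingAlgebra.ι ℂ x) w := by
      intro w
      rw [envAction, UniversalEnvelopingAlgebra.lift_ι_apply]; rfl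
    rw [hx v, ← Module.End.mul_apply, ← map_mul,
      ← (Subalgebra.mem_center_iff.mp z.2 (UniversalEnvelopingAlgebra.ι ℂ x)), map_mul,
      Module.End.mul_apply, hk z hz, map_zero]

/-- The subspace `𝔫₋ X`, spanned by all `y v` with `y ∈ 𝔫₋`, as an `𝔥`-submodule. -/
def nMinusMul : LieSubmodule ℂ (cartan n) X where
  toSubmodule := Submodule.span ℂ {w | ∃ (y : nMinus n) (v : X), ⁅(y : SL n), v⁆ = w}
  lie_mem := by
    intro h w hw
    change w ∈ Submodule.span ℂ _ at hw
    change ⁅h, w⁆ ∈ Submodule.span ℂ _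
    induction hw using Submodule.span_induction with
    | mem w hw =>
      obtain ⟨y, v, rfl⟩ := hw
      change ⁅(h : SL n), ⁅(y : SL n), v⁆⁆ ∈ _
      rw [leibniz_lie]
      exact add_mem
        (Submodule.subset_span ⟨⟨_, lie_cartan_nMinus h y⟩, v, rfl⟩)
        (Submodule.subset_span ⟨y, _, rfl⟩)
    | zero => rw [lie_zero]; exact zero_mem _
    | add a b _ _ ha hb => rw [lie_add]; exact add_mem ha hb
    | smul c a _ ha => rw [lie_smul]; exact Submodule.smul_mem _ c ha

/-- `H₀(𝔫₋, X) = X / 𝔫₋ X`, an `𝔥`-module. -/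
abbrev H0 (n : ℕ) (X : Type*) [AddCommGroup X] [Module ℂ X]
    [LieRingModule (SL n) X] [LieModule ℂ (SL n) X] : Type _ :=
  X ⧸ nMinusMul (n := n) X

/-- The natural map `(X^[wt])_wt → H₀(𝔫₋, X)_wt`, `v ↦ v + 𝔫₋ X`. -/
def naturalMap (wt : Weight n) :
    weightSpace (block X wt) wt →ₗ[ℂ] weightSpace (H0 n X) wt :=
  LinearMap.restrict
    ((LieSubmodule.Quotient.mk' (nMinusMul (n := n) X) : X →ₗ[ℂ] H0 n X).comp
      ((block X wt).incl : block X wt →ₗ[ℂ] X))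
    (by
      intro v hv
      replace hv := mem_weightSpace.mp hv
      refine mem_weightSpace.mpr fun h => ?_
      have := congrArg (fun w : block X wt => LieSubmodule.Quotient.mk' (nMinusMul (n := n) X)
        (w : X)) (hv h)
      simp only [LieSubmodule.coe_smul, map_smul] at this
      rw [LinearMap.comp_apply]
      refine Eq.trans ?_ this
      exact (LieModuleHom.map_lie (LieSubmodule.Quotient.mk' (nMinusMul (n := n) X)) h (v : X)).symm)

end Modules

end CategoryO

end

/-! Write C = ∑ Eᵢⱼ Eⱼᵢ for the Casimir element and c(μ) for the scalar by which it acts on M(μ).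
Then D = C − c(λ) belongs to Z_λ, and this single element of Z_λ is enough for injectivity.

Injectivity: a vector v of weight λ in 𝔫₋X lies in Q = ∑ f_α X_{λ+α}, the sum over the positive
roots α, where f_α spans the root space of −α (`mem_lowerWeight`). If D had a kernel on X_{λ+α},
raising operators would lead from a nonzero vector of it to a singular vector of weight λ+β, with β
a nonzero sum of positive roots, so that c(λ+β) = c(λ). But c(λ+β) − c(λ) = (β,β) + 2(λ+ρ,β), where
the first term is positive and the second is nonnegative by dominance
(`eq_zero_of_casimirScalar_eq`). Hence D is bijective on each finite-dimensional X_{λ+α}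
(`shiftedCasimir_injOn`). Since D commutes with f_α, DQ = Q, so D is injective on Q
(`lowerWeight_le_map`). If v is in the block, some power of D kills it, and v = 0.

Surjectivity: an element z of Z_λ lies in the left ideal defining M(λ), so zx ∈ U(𝔰𝔩ₙ)𝔫₊x for x ∈
X_λ. Straightening puts the weight λ part of this into 𝔫₋X (`infCharKer_mem_lower_top`). Fitting's
lemma on X_λ gives z ∈ Z_λ such that 1 − z maps X_λ into X^[λ] (`exists_fitting`), and x and x − zx
have the same class modulo 𝔫₋X. -/

noncomputable section

namespace CategoryO

/-! ### Generation of the enveloping algebra by the Lie algebra. -/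

section Enveloping

variable {L : Type*} [LieRing L] [LieAlgebra ℂ L]

/-- A subalgebra of the enveloping algebra which contains `L` is everything. -/
theorem enveloping_subalgebra_eq_top (S : Subalgebra ℂ (UniversalEnvelopingAlgebra ℂ L))
    (hS : ∀ x : L, UniversalEnvelopingAlgebra.ι ℂ x ∈ S) (u : UniversalEnvelopingAlgebra ℂ L) :
    u ∈ S := by
  let f : L →ₗ⁅ℂ⁆ S :=
    { toFun := fun x => ⟨UniversalEnvelopingAlgebra.ι ℂ x, hS x⟩
      map_add' := fun x y => Subtype.ext (map_add _ x y)
      map_smul' := fun c x => Subtype.ext (map_smul _ c x)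
      map_lie' := fun {x y} => Subtype.ext (LieHom.map_lie _ x y) }
  -- By the universal property this composite is the identity, so every `u` comes from `S`.
  have h : S.val.comp (UniversalEnvelopingAlgebra.lift ℂ f) =
      AlgHom.id ℂ (UniversalEnvelopingAlgebra ℂ L) := by
    ext x
    change ((UniversalEnvelopingAlgebra.lift ℂ f (UniversalEnvelopingAlgebra.ι ℂ x) : S) :
      UniversalEnvelopingAlgebra ℂ L) = UniversalEnvelopingAlgebra.ι ℂ x
    rw [UniversalEnvelopingAlgebra.lift_ι_apply]
    rfl
  have hu := DFunLike.congr_fun h u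
  rw [AlgHom.id_apply] at hu
  rw [← hu]
  exact (UniversalEnvelopingAlgebra.lift ℂ f u).2

variable {X : Type*} [AddCommGroup X] [Module ℂ X] [LieRingModule L X] [LieModule ℂ L X]

theorem envAction_ι (x : L) (v : X) :
    envAction L X (UniversalEnvelopingAlgebra.ι ℂ x) v = ⁅x, v⁆ := by
  rw [envAction, UniversalEnvelopingAlgebra.lift_ι_apply]; rfl

theorem envAction_mem (N : Submodule ℂ X) (hN : ∀ (x : L), ∀ v ∈ N, ⁅x, v⁆ ∈ N)
    (u : UniversalEnvelopingAlgebra ℂ L) : ∀ v ∈ N, envAction L X u v ∈ N := by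
  let S : Subalgebra ℂ (UniversalEnvelopingAlgebra ℂ L) :=
    { carrier := {u | ∀ v ∈ N, envAction L X u v ∈ N}
      mul_mem' := fun {a b} ha hb v hv => by
        rw [map_mul, Module.End.mul_apply]; exact ha _ (hb v hv)
      add_mem' := fun {a b} ha hb v hv => by
        rw [map_add, LinearMap.add_apply]; exact add_mem (ha v hv) (hb v hv)
      algebraMap_mem' := fun c v hv => by
        rw [AlgHom.commutes, Module.algebraMap_end_apply]; exact N.smul_mem c hv }
  exact enveloping_subalgebra_eq_top S (fun x v hv => by rw [envAction_ι]; exact hN x v hv) u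

end Enveloping

/-! ### Matrix units projected to trace zero, and roots. -/

section Matrices

variable {n : ℕ}

/-- The projection of `𝔤𝔩ₙ` onto `𝔰𝔩ₙ` along the scalar matrices. -/
def slProj (n : ℕ) : Matrix (Fin n) (Fin n) ℂ →ₗ[ℂ] SL n where
  toFun A := ⟨A - (A.trace / n) • (1 : Matrix (Fin n) (Fin n) ℂ), by
    -- For `n = 0` the division returns 0 and `n` cannot be cancelled; the trace then vanishes
    -- because the index type is empty.
    rcases Nat.eq_zero_or_pos n with rfl | hn
    · exact Matrix.trace_eq_zero_of_isEmpty
        (A - (A.trace / ((0 : ℕ) : ℂ)) • (1 : Matrix (Fin 0) (Fin 0) ℂ))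
    · change Matrix.trace (A - (A.trace / n) • (1 : Matrix (Fin n) (Fin n) ℂ)) = 0
      have : (n : ℂ) ≠ 0 := by exact_mod_cast hn.ne'
      rw [Matrix.trace_sub, Matrix.trace_smul, Matrix.trace_one, Fintype.card_fin, smul_eq_mul,
        div_mul_cancel₀ _ this, sub_self]⟩
  map_add' A B := Subtype.ext (by
    change A + B - ((A + B).trace / n) • (1 : Matrix (Fin n) (Fin n) ℂ) =
      (A - (A.trace / n) • 1) + (B - (B.trace / n) • 1)
    rw [Matrix.trace_add, add_div, add_smul]; abel)
  map_smul' c A := Subtype.ext (by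
    change c • A - ((c • A).trace / n) • (1 : Matrix (Fin n) (Fin n) ℂ) =
      c • (A - (A.trace / n) • 1)
    rw [Matrix.trace_smul, smul_sub, smul_smul, smul_eq_mul, mul_div_assoc])

theorem slProj_val (A : Matrix (Fin n) (Fin n) ℂ) :
    (slProj n A).val = A - (A.trace / n) • (1 : Matrix (Fin n) (Fin n) ℂ) := rfl

theorem slProj_coe (A : SL n) : slProj n A.val = A := by
  apply Subtype.ext
  have : Matrix.trace A.val = 0 := A.2
  rw [slProj_val, this, zero_div, zero_smul, sub_zero]

theorem slProj_lie (A B : Matrix (Fin n) (Fin n) ℂ) :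
    ⁅slProj n A, slProj n B⁆ = slProj n (A * B - B * A) := by
  apply Subtype.ext
  rw [LieAlgebra.SpecialLinear.sl_bracket, slProj_val, slProj_val, slProj_val, Matrix.trace_sub,
    Matrix.trace_mul_comm B A, sub_self, zero_div, zero_smul, sub_zero]
  simp only [sub_mul, mul_sub, smul_mul_assoc, mul_smul_comm, one_mul, mul_one, smul_sub]
  rw [smul_comm (Matrix.trace A / (n : ℂ))]
  abel

/-- The image in `𝔰𝔩ₙ` of the matrix unit `Eᵢⱼ`. -/
def unit (i j : Fin n) : SL n := slProj n (Matrix.single i j 1)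

/-- Scalar matrices are central and commutators have trace zero, so the relations of 𝔤𝔩ₙ survive the
projection. The diagonal units sum to zero, but all indices can be treated uniformly. -/
theorem unit_lie_unit (i j k l : Fin n) :
    ⁅unit i j, unit k l⁆ =
      (if j = k then unit i l else 0) - (if l = i then unit k j else 0) := by
  rw [unit, unit, slProj_lie, map_sub]
  congr 1
  · split_ifs with h
    · subst h; rw [Matrix.single_mul_single_same, one_mul]; rfl
    · rw [Matrix.single_mul_single_of_ne _ _ _ _ h, map_zero]
  · split_ifs with h
    · subst h; rw [Matrix.single_mul_single_same, one_mul]; rfl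
    · rw [Matrix.single_mul_single_of_ne _ _ _ _ h, map_zero]

theorem eq_sum_unit (A : SL n) : A = ∑ i, ∑ j, A.val i j • unit i j := by
  conv_lhs => rw [← slProj_coe A, Matrix.matrix_eq_sum_single A.val]
  simp only [map_sum]
  refine Finset.sum_congr rfl fun i _ => Finset.sum_congr rfl fun j _ => ?_
  rw [unit, ← map_smul, Matrix.smul_single, smul_eq_mul, mul_one]

theorem unit_val_of_ne {i j : Fin n} (h : i ≠ j) : (unit i j).val = Matrix.single i j 1 := by
  rw [unit, slProj_val, Matrix.trace_single_eq_of_ne _ _ _ h, zero_div, zero_smul, sub_zero]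

theorem unit_mem_nPlus {i j : Fin n} (h : i < j) : unit i j ∈ nPlus n := by
  intro a b hab
  rw [unit_val_of_ne h.ne, Matrix.single_apply, if_neg]
  rintro ⟨rfl, rfl⟩
  exact absurd h (not_lt.mpr hab)

theorem unit_mem_nMinus {i j : Fin n} (h : j < i) : unit i j ∈ nMinus n := by
  intro a b hab
  rw [unit_val_of_ne h.ne', Matrix.single_apply, if_neg]
  rintro ⟨rfl, rfl⟩
  exact absurd h (not_lt.mpr hab)

/-- The image of `Eᵢᵢ` in the Cartan subalgebra. -/
def diagUnit (i : Fin n) : cartan n := ⟨unit i i, by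
  intro a b hab
  rw [unit, slProj_val, Matrix.sub_apply, Matrix.smul_apply, Matrix.one_apply_ne hab, smul_zero,
    sub_zero, Matrix.single_apply, if_neg]
  rintro ⟨rfl, rfl⟩
  exact hab rfl⟩

theorem coe_diagUnit (i : Fin n) : (diagUnit i : SL n) = unit i i := rfl

theorem cartan_eq_sum (h : cartan n) : h = ∑ i, eps i h • diagUnit i := by
  apply Subtype.ext
  rw [AddSubmonoidClass.coe_finsetSum]
  conv_lhs => rw [eq_sum_unit (h : SL n)]
  refine Finset.sum_congr rfl fun i _ => ?_
  rw [Finset.sum_eq_single i]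
  · rfl
  · intro j _ hj
    rw [h.2 i j hj.symm, zero_smul]
  · simp

/-- The root `εᵢ - εⱼ`. -/
def root (i j : Fin n) : Weight n := eps i - eps j

theorem eps_diagUnit (i j : Fin n) :
    eps i (diagUnit j) = (if i = j then 1 else 0) - 1 / (n : ℂ) := by
  change (slProj n (Matrix.single j j 1)).val i i = _
  rw [slProj_val, Matrix.trace_single_eq_same, Matrix.sub_apply, Matrix.smul_apply,
    Matrix.one_apply_eq, Matrix.single_apply, smul_eq_mul, mul_one]
  congr 1
  simp [eq_comm]

theorem root_diagUnit (i j k : Fin n) :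
    root i j (diagUnit k) = (if i = k then 1 else 0) - (if j = k then 1 else 0) := by
  rw [root, LinearMap.sub_apply, eps_diagUnit, eps_diagUnit]; ring

theorem cartan_lie_unit (h : cartan n) (i j : Fin n) :
    ⁅(h : SL n), unit i j⁆ = root i j h • unit i j := by
  have key : ∀ k, ⁅(diagUnit k : SL n), unit i j⁆ = root i j (diagUnit k) • unit i j := by
    intro k
    rw [coe_diagUnit, unit_lie_unit, root_diagUnit, sub_smul]
    congr 1
    · by_cases hk : k = i
      · subst hk; simp
      · simp [hk, Ne.symm hk]
    · by_cases hk : j = k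
      · subst hk; simp
      · simp [hk]
  rw [cartan_eq_sum h, AddSubmonoidClass.coe_finsetSum, map_sum, Finset.sum_smul,
    sum_lie]
  refine Finset.sum_congr rfl fun k _ => ?_
  change ⁅eps k h • (diagUnit k : SL n), unit i j⁆ = _
  rw [smul_lie, key, map_smul, smul_eq_mul, mul_smul]

end Matrices

/-! ### The Casimir element, its centrality and its value on Verma modules. -/

section Casimir

open UniversalEnvelopingAlgebra

variable {n : ℕ}

/-- The image of `Eᵢⱼ` in the enveloping algebra. -/
def envUnit (i j : Fin n) : UniversalEnvelopingAlgebra ℂ (SL n) := ι ℂ (unit i j)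

theorem envUnit_mul_sub (i j k l : Fin n) :
    envUnit i j * envUnit k l - envUnit k l * envUnit i j =
      (if j = k then envUnit i l else 0) - (if l = i then envUnit k j else 0) := by
  have h := LieHom.map_lie (ι ℂ) (unit i j) (unit k l)
  rw [LieRing.of_associative_ring_bracket] at h
  rw [envUnit, envUnit, ← h, unit_lie_unit, map_sub]
  congr 1 <;> split_ifs <;> simp [envUnit]

variable (n) in
/-- The Casimir element `∑ Eᵢⱼ Eⱼᵢ`. -/
def casimir : UniversalEnvelopingAlgebra ℂ (SL n) :=
  ∑ p : Fin n × Fin n, envUnit p.1 p.2 * envUnit p.2 p.1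

/-- The commutator with Eₖₗ is a derivation. Applied to the double sum it yields four single sums,
which cancel in pairs. -/
theorem envUnit_mul_casimir (k l : Fin n) :
    envUnit k l * casimir n = casimir n * envUnit k l := by
  rw [← sub_eq_zero, casimir, Finset.mul_sum, Finset.sum_mul, ← Finset.sum_sub_distrib]
  have h : ∀ p : Fin n × Fin n,
      envUnit k l * (envUnit p.1 p.2 * envUnit p.2 p.1) -
        envUnit p.1 p.2 * envUnit p.2 p.1 * envUnit k l =
      ((if l = p.1 then envUnit k p.2 * envUnit p.2 p.1 else 0) -
        (if p.2 = k then envUnit p.1 l * envUnit p.2 p.1 else 0)) +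
      ((if l = p.2 then envUnit p.1 p.2 * envUnit k p.1 else 0) -
        (if p.1 = k then envUnit p.1 p.2 * envUnit p.2 l else 0)) := by
    intro p
    have h1 := envUnit_mul_sub k l p.1 p.2
    have h2 := envUnit_mul_sub k l p.2 p.1
    calc _ = (envUnit k l * envUnit p.1 p.2 - envUnit p.1 p.2 * envUnit k l) * envUnit p.2 p.1 +
          envUnit p.1 p.2 * (envUnit k l * envUnit p.2 p.1 - envUnit p.2 p.1 * envUnit k l) := by
            noncomm_ring
      _ = _ := by
        rw [h1, h2, sub_mul, mul_sub]
        simp only [ite_mul, mul_ite, zero_mul, mul_zero]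
  rw [Finset.sum_congr rfl fun p _ => h p]
  simp only [Finset.sum_add_distrib, Finset.sum_sub_distrib, Fintype.sum_prod_type]
  simp only [Finset.sum_ite_eq, Finset.sum_ite_eq', Finset.mem_univ, if_true]
  rw [Finset.sum_comm (f := fun x y => if l = x then envUnit k y * envUnit y x else 0)]
  rw [Finset.sum_comm (f := fun x y => if x = k then envUnit x y * envUnit y l else 0)]
  simp only [Finset.sum_ite_eq, Finset.sum_ite_eq', Finset.mem_univ, if_true]
  abel

theorem casimir_mem_center : casimir n ∈ Center n := by
  rw [Subalgebra.mem_center_iff]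
  intro u
  have := enveloping_subalgebra_eq_top (Subalgebra.centralizer ℂ {casimir n}) (fun x => by
    rw [Subalgebra.mem_centralizer_iff]
    rintro _ rfl
    rw [eq_sum_unit x]
    simp only [map_sum, map_smul, Finset.mul_sum, Finset.sum_mul, mul_smul_comm, smul_mul_assoc]
    refine Finset.sum_congr rfl fun i _ => Finset.sum_congr rfl fun j _ => ?_
    rw [← envUnit, envUnit_mul_casimir]) u
  exact ((Subalgebra.mem_centralizer_iff ℂ).mp this _ rfl).symm

/-- The scalar by which the Casimir element acts on a vector of highest weight `μ`. -/
def casimirScalar (μ : Weight n) : ℂ :=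
  ∑ i, μ (diagUnit i) ^ 2 +
    ∑ p : Fin n × Fin n with p.1 < p.2, (μ (diagUnit p.1) - μ (diagUnit p.2))

/-- Modulo the left ideal only the rightmost factor matters. For i < j, Eᵢⱼ Eⱼᵢ = Eⱼᵢ Eᵢⱼ + Eᵢᵢ −
Eⱼⱼ; for i > j the product already ends in 𝔫₊; and Eᵢᵢ² − μ(Eᵢᵢ)² has the right factor Eᵢᵢ − μ(Eᵢᵢ).
-/
theorem casimir_sub_mem_vermaIdeal (μ : Weight n) :
    casimir n - algebraMap ℂ _ (casimirScalar μ) ∈ vermaIdeal μ := by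
  have he : ∀ i j : Fin n, i < j → envUnit i j ∈ vermaIdeal μ := fun i j h =>
    Submodule.subset_span (Or.inl ⟨⟨_, unit_mem_nPlus h⟩, rfl⟩)
  have hd : ∀ i : Fin n, envUnit i i - algebraMap ℂ _ (μ (diagUnit i)) ∈ vermaIdeal μ := fun i =>
    Submodule.subset_span (Or.inr ⟨diagUnit i, rfl⟩)
  have hsum : casimirScalar μ = ∑ p : Fin n × Fin n,
      ((if p.1 = p.2 then μ (diagUnit p.1) ^ 2 else 0) +
        if p.1 < p.2 then μ (diagUnit p.1) - μ (diagUnit p.2) else 0) := by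
    rw [casimirScalar, Finset.sum_add_distrib, Finset.sum_filter, Fintype.sum_prod_type
      (f := fun p : Fin n × Fin n => if p.1 = p.2 then μ (diagUnit p.1) ^ 2 else 0)]
    simp
  rw [hsum, casimir, map_sum, ← Finset.sum_sub_distrib]
  refine sum_mem fun p _ => ?_
  obtain ⟨i, j⟩ := p
  dsimp only
  rcases lt_trichotomy i j with h | rfl | h
  · rw [if_neg h.ne, if_pos h, zero_add]
    have hc := envUnit_mul_sub i j j i
    rw [if_pos rfl, if_pos rfl] at hc
    have : envUnit i j * envUnit j i - algebraMap ℂ (UniversalEnvelopingAlgebra ℂ (SL n))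
          (μ (diagUnit i) - μ (diagUnit j)) =
        envUnit j i • envUnit i j + ((envUnit i i - algebraMap ℂ _ (μ (diagUnit i))) -
          (envUnit j j - algebraMap ℂ _ (μ (diagUnit j)))) := by
      rw [smul_eq_mul, eq_add_of_sub_eq hc, map_sub]; abel
    rw [this]
    exact add_mem (Submodule.smul_mem _ _ (he i j h)) (sub_mem (hd i) (hd j))
  · rw [if_pos rfl, if_neg (lt_irrefl _), add_zero]
    have : envUnit i i * envUnit i i - algebraMap ℂ (UniversalEnvelopingAlgebra ℂ (SL n))
          (μ (diagUnit i) ^ 2) =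
        (envUnit i i + algebraMap ℂ _ (μ (diagUnit i))) •
          (envUnit i i - algebraMap ℂ _ (μ (diagUnit i))) := by
      rw [smul_eq_mul, add_mul, mul_sub, mul_sub, pow_two, map_mul,
        Algebra.commutes (μ (diagUnit i)) (envUnit i i)]
      abel
    rw [this]
    exact Submodule.smul_mem _ _ (hd i)
  · rw [if_neg h.ne', if_neg h.not_gt, add_zero, map_zero, sub_zero]
    exact Submodule.smul_mem _ (envUnit i j) (he j i h)

/-- The Casimir element, shifted so that it acts by zero on `M(μ)`. -/
def shiftedCasimir (μ : Weight n) : Center n :=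
  ⟨casimir n, casimir_mem_center⟩ - algebraMap ℂ _ (casimirScalar μ)

theorem coe_shiftedCasimir (μ : Weight n) :
    (shiftedCasimir μ : UniversalEnvelopingAlgebra ℂ (SL n)) =
      casimir n - algebraMap ℂ _ (casimirScalar μ) := rfl

/-- A central element kills the cyclic module M(μ) as soon as it kills the generator. -/
theorem mem_infCharKer {μ : Weight n} {z : Center n} :
    z ∈ infCharKer μ ↔ (z : UniversalEnvelopingAlgebra ℂ (SL n)) ∈ vermaIdeal μ := by
  rw [infCharKer, Module.mem_annihilator]
  constructor
  · intro h
    have h1 := h (Submodule.Quotient.mk 1)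
    have h2 : z • (Submodule.Quotient.mk 1 : Verma μ) =
      Submodule.Quotient.mk (z : UniversalEnvelopingAlgebra ℂ (SL n)) := by
      change Submodule.Quotient.mk ((z : UniversalEnvelopingAlgebra ℂ (SL n)) * 1) = _
      rw [mul_one]
    rwa [h2, Submodule.Quotient.mk_eq_zero] at h1
  · intro h m
    obtain ⟨u, rfl⟩ := Submodule.Quotient.mk_surjective _ m
    change Submodule.Quotient.mk ((z : UniversalEnvelopingAlgebra ℂ (SL n)) * u) = _
    rw [Submodule.Quotient.mk_eq_zero, ← Subalgebra.mem_center_iff.mp z.2 u]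
    exact Submodule.smul_mem _ u h

theorem shiftedCasimir_mem_infCharKer (μ : Weight n) : shiftedCasimir μ ∈ infCharKer μ := by
  rw [mem_infCharKer, coe_shiftedCasimir]
  exact casimir_sub_mem_vermaIdeal μ

end Casimir

/-! ### Dominance and strict growth of the Casimir scalar. -/

section Dominance

variable {n : ℕ}

variable (n) in
/-- The submonoid of `𝔥*` generated by the positive roots. -/
def positiveCone : AddSubmonoid (Weight n) :=
  AddSubmonoid.closure {β | ∃ i j : Fin n, i < j ∧ β = root i j}

theorem root_mem_positiveCone {i j : Fin n} (h : i < j) : root i j ∈ positiveCone n :=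
  AddSubmonoid.subset_closure ⟨i, j, h, rfl⟩

theorem simpleCoroot_eq (i : ℕ) (hi : i + 1 < n) :
    simpleCoroot i hi = diagUnit ⟨i, Nat.lt_of_succ_lt hi⟩ - diagUnit ⟨i + 1, hi⟩ := by
  apply Subtype.ext
  apply Subtype.ext
  change Matrix.single _ _ (1 : ℂ) - Matrix.single _ _ 1 =
    (slProj n (Matrix.single _ _ 1)).val - (slProj n (Matrix.single _ _ 1)).val
  rw [slProj_val, slProj_val, Matrix.trace_single_eq_same, Matrix.trace_single_eq_same]
  abel

theorem IsDominantIntegral.exists_nat {μ : Weight n} (hμ : IsDominantIntegral μ) {i j : Fin n}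
    (hij : i ≤ j) : ∃ m : ℕ, μ (diagUnit i - diagUnit j) = m := by
  obtain ⟨i, hi⟩ := i
  obtain ⟨j, hj⟩ := j
  replace hij : i ≤ j := hij
  induction j, hij using Nat.le_induction with
  | base => exact ⟨0, by simp⟩
  | succ j hij ih =>
    obtain ⟨m, hm⟩ := ih (Nat.lt_of_succ_lt hj)
    obtain ⟨m', hm'⟩ := hμ j hj
    refine ⟨m + m', ?_⟩
    rw [simpleCoroot_eq] at hm'
    rw [Nat.cast_add, ← hm, ← hm', ← map_add]
    congr 1
    abel

theorem positiveCone_diagUnit {β : Weight n} (hβ : β ∈ positiveCone n) (i : Fin n) :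
    ∃ m : ℤ, β (diagUnit i) = m := by
  induction hβ using AddSubmonoid.closure_induction with
  | mem β h =>
    obtain ⟨a, b, -, rfl⟩ := h
    refine ⟨(if a = i then 1 else 0) - (if b = i then 1 else 0), ?_⟩
    rw [root_diagUnit]
    push_cast
    rfl
  | zero => exact ⟨0, by simp⟩
  | add β γ _ _ h h' =>
    obtain ⟨m, hm⟩ := h
    obtain ⟨m', hm'⟩ := h'
    exact ⟨m + m', by rw [LinearMap.add_apply, hm, hm', Int.cast_add]⟩

/-- The derivative of the Casimir scalar at `μ`, as an element of `𝔥`. -/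
def casimirGradient (μ : Weight n) : cartan n :=
  (2 : ℂ) • ∑ i, μ (diagUnit i) • diagUnit i +
    ∑ p : Fin n × Fin n with p.1 < p.2, (diagUnit p.1 - diagUnit p.2)

theorem casimirScalar_add (μ β : Weight n) :
    casimirScalar (μ + β) =
      casimirScalar μ + (∑ i, β (diagUnit i) ^ 2 + β (casimirGradient μ)) := by
  simp only [casimirScalar, casimirGradient, map_add, map_smul, map_sum, map_sub,
    LinearMap.add_apply, smul_eq_mul, Finset.mul_sum, Finset.sum_sub_distrib,
    Finset.sum_add_distrib, add_sq]
  have : ∑ x, 2 * μ (diagUnit x) * β (diagUnit x) = ∑ x, 2 * (μ (diagUnit x) * β (diagUnit x)) :=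
    Finset.sum_congr rfl fun _ _ => by ring
  rw [this]
  ring

/-- Both sides rest on the symmetry of the pairing (εₐ − ε_b)(Eᵢᵢ − Eⱼⱼ) in its two pairs of
indices, which turns the sum of positive coroots into 2ρ. -/
theorem root_casimirGradient (μ : Weight n) (a b : Fin n) :
    root a b (casimirGradient μ) = 2 * (μ + rho n) (diagUnit a - diagUnit b) := by
  have h1 : root a b (∑ i, μ (diagUnit i) • diagUnit i) = μ (diagUnit a - diagUnit b) := by
    simp only [map_sum, map_smul, root_diagUnit, smul_eq_mul, mul_sub, Finset.sum_sub_distrib,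
      map_sub, mul_ite, mul_one, mul_zero, Finset.sum_ite_eq, Finset.mem_univ, if_true]
  have h2 : root a b (∑ p : Fin n × Fin n with p.1 < p.2, (diagUnit p.1 - diagUnit p.2)) =
      2 * rho n (diagUnit a - diagUnit b) := by
    rw [rho, LinearMap.smul_apply, LinearMap.sum_apply, map_sum, smul_eq_mul, ← mul_assoc]
    rw [mul_one_div_cancel two_ne_zero, one_mul]
    refine Finset.sum_congr rfl fun p _ => ?_
    change _ = root p.1 p.2 _
    rw [map_sub, map_sub, root_diagUnit, root_diagUnit, root_diagUnit, root_diagUnit]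
    simp only [eq_comm]
    ring
  rw [casimirGradient, map_add, map_smul, h1, h2, LinearMap.add_apply, smul_eq_mul, mul_add]

theorem positiveCone_casimirGradient {μ β : Weight n} (hμ : IsDominantIntegral (μ + rho n))
    (hβ : β ∈ positiveCone n) : ∃ m : ℕ, β (casimirGradient μ) = m := by
  induction hβ using AddSubmonoid.closure_induction with
  | mem β h =>
    obtain ⟨a, b, hab, rfl⟩ := h
    obtain ⟨m, hm⟩ := hμ.exists_nat hab.le
    exact ⟨2 * m, by rw [root_casimirGradient, hm]; push_cast; rfl⟩
  | zero => exact ⟨0, by simp⟩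
  | add β γ _ _ h h' =>
    obtain ⟨m, hm⟩ := h
    obtain ⟨m', hm'⟩ := h'
    exact ⟨m + m', by rw [LinearMap.add_apply, hm, hm', Nat.cast_add]⟩

/-- The increment of the scalar is a sum of squares of the integers β(Eᵢᵢ) plus a natural number, so
its vanishing forces every β(Eᵢᵢ) = 0. -/
theorem eq_zero_of_casimirScalar_eq {μ β : Weight n} (hμ : IsDominantIntegral (μ + rho n))
    (hβ : β ∈ positiveCone n) (h : casimirScalar (μ + β) = casimirScalar μ) : β = 0 := by
  obtain ⟨m, hm⟩ := positiveCone_casimirGradient hμ hβ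
  choose b hb using positiveCone_diagUnit hβ
  rw [casimirScalar_add, add_eq_left, hm, Finset.sum_congr rfl fun i _ => by rw [hb i]] at h
  have h' : ∑ i, b i ^ 2 + (m : ℤ) = 0 := by exact_mod_cast h
  have hs : ∑ i, b i ^ 2 = 0 := by
    have : 0 ≤ ∑ i, b i ^ 2 := Finset.sum_nonneg fun i _ => sq_nonneg _
    omega
  rw [Finset.sum_eq_zero_iff_of_nonneg fun i _ => sq_nonneg _] at hs
  ext x
  rw [cartan_eq_sum x, map_sum, LinearMap.zero_apply]
  refine Finset.sum_eq_zero fun i hi => ?_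
  rw [map_smul, hb, pow_eq_zero_iff two_ne_zero |>.mp (hs i hi), Int.cast_zero, smul_zero]

end Dominance

/-! ### Weight projections, heights and the filtration of U(𝔫₋)F. -/

section WeightModules

variable {n : ℕ} {X : Type*} [AddCommGroup X] [Module ℂ X]
  [LieRingModule (SL n) X] [LieModule ℂ (SL n) X]

theorem lie_unit_mem_weightSpace {μ : Weight n} {x : X} (hx : x ∈ weightSpace X μ)
    (i j : Fin n) : ⁅unit i j, x⁆ ∈ weightSpace X (μ + root i j) := by
  rw [mem_weightSpace] at hx ⊢
  intro h
  have hh : ⁅(h : SL n), x⁆ = μ h • x := hx h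
  change ⁅(h : SL n), ⁅unit i j, x⁆⁆ = _
  rw [leibniz_lie, cartan_lie_unit, hh, smul_lie, lie_smul, ← add_smul, add_comm]
  rfl

variable (n X) in
/-- The projections of a weight module onto its weight spaces. -/
structure WeightProjections where
  /-- The projection onto the weight space of weight `μ`. -/
  proj : Weight n → X →ₗ[ℂ] X
  proj_mem : ∀ μ x, proj μ x ∈ weightSpace X μ
  proj_same : ∀ {μ x}, x ∈ weightSpace X μ → proj μ x = x
  proj_ne : ∀ {μ ν x}, x ∈ weightSpace X μ → μ ≠ ν → proj ν x = 0
  exists_sum : ∀ x, ∃ s : Finset (Weight n), ∑ μ ∈ s, proj μ x = x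

open Classical in
theorem IsObject.nonempty_weightProjections (hX : IsObject n X) :
    Nonempty (WeightProjections n X) := by
  let := hX.weightDecomposition.chooseDecomposition
  let 𝒳 : Weight n → Submodule ℂ X := fun μ => weightSpace X μ
  exact ⟨{
    proj := fun μ => (weightSpace X μ).subtype ∘ₗ 
      DirectSum.component ℂ (Weight n) (fun ν => weightSpace X ν) μ ∘ₗ
      (DirectSum.decomposeLinearEquiv 𝒳).toLinearMap
    proj_mem := fun μ x => Subtype.mem _
    proj_same := fun {μ x} hx => DirectSum.decompose_of_mem_same 𝒳 hx
    proj_ne := fun {μ ν x} hx h => DirectSum.decompose_of_mem_ne 𝒳 hx h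
    exists_sum := fun x => ⟨_, DirectSum.sum_support_decompose 𝒳 x⟩ }⟩

namespace WeightProjections

theorem induction (P : WeightProjections n X) {motive : X → Prop}
    (mem : ∀ μ : Weight n, ∀ x ∈ weightSpace X μ, motive x)
    (zero : motive 0) (add : ∀ x y, motive x → motive y → motive (x + y)) (x : X) : motive x := by
  obtain ⟨s, hs⟩ := P.exists_sum x
  rw [← hs]
  exact Finset.sum_induction _ motive add zero fun μ _ => mem μ _ (P.proj_mem μ x)

variable (P : WeightProjections n X)

theorem proj_lie (ν : Weight n) (i j : Fin n) (x : X) :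
    P.proj ν ⁅unit i j, x⁆ = ⁅unit i j, P.proj (ν - root i j) x⁆ := by
  induction x using P.induction with
  | mem μ x hx =>
    by_cases h : μ = ν - root i j
    · have h' := lie_unit_mem_weightSpace hx i j
      rw [h, sub_add_cancel] at h'
      rw [h] at hx
      rw [P.proj_same hx, P.proj_same h']
    · rw [P.proj_ne hx h, lie_zero]
      refine P.proj_ne (lie_unit_mem_weightSpace hx i j) fun h' => h ?_
      rw [← h', add_sub_cancel_right]
  | zero => simp
  | add x y hx hy => rw [lie_add, map_add, map_add, lie_add, hx, hy]

end WeightProjections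

variable (n) in
/-- The element of `𝔥` on which the root `εᵢ - εⱼ` takes the value `j - i`. -/
def heightElement : cartan n := ∑ i : Fin n, (-((i : ℕ) : ℂ)) • diagUnit i

/-- The height of a weight. -/
def height (μ : Weight n) : ℝ := (μ (heightElement n)).re

theorem height_add (μ ν : Weight n) : height (μ + ν) = height μ + height ν := rfl

theorem height_sub (μ ν : Weight n) : height (μ - ν) = height μ - height ν := rfl

/-- Positive roots raise the height by at least 1 and negative roots lower it by at least 1. The
real part in `height` serves to compare arbitrary complex weights. -/
theorem height_root (i j : Fin n) : height (root i j) = (j : ℕ) - (i : ℕ) := by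
  have : root i j (heightElement n) = ((j : ℕ) : ℂ) - ((i : ℕ) : ℂ) := by
    simp [heightElement, map_sum, root_diagUnit, mul_sub, Finset.sum_sub_distrib]
  rw [height, this]
  simp

theorem height_root_ge_one {i j : Fin n} (h : i < j) : 1 ≤ height (root i j) := by
  rw [height_root]
  have : ((i : ℕ) : ℝ) + 1 ≤ (j : ℕ) := by exact_mod_cast h
  linarith

theorem height_root_nonneg {i j : Fin n} (h : i ≤ j) : 0 ≤ height (root i j) := by
  rw [height_root]
  have : ((i : ℕ) : ℝ) ≤ (j : ℕ) := by exact_mod_cast h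
  linarith

theorem height_root_le_neg_one {i j : Fin n} (h : j < i) : height (root i j) ≤ -1 := by
  rw [height_root]
  have : ((j : ℕ) : ℝ) + 1 ≤ (i : ℕ) := by exact_mod_cast h
  linarith

/-- A subspace which is stable under the Borel subalgebra `𝔥 + 𝔫₊`. -/
def IsBorelStable (F : Submodule ℂ X) : Prop :=
  ∀ i j : Fin n, i ≤ j → ∀ x ∈ F, ⁅unit i j, x⁆ ∈ F

/-- The subspace `𝔫₋ T`. -/
def lower (T : Submodule ℂ X) : Submodule ℂ X :=
  ⨆ (i : Fin n) (j : Fin n) (_ : j < i), T.map (LieModule.toEnd ℂ (SL n) X (unit i j))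

theorem lie_mem_lower {T : Submodule ℂ X} {i j : Fin n} (h : j < i) {x : X} (hx : x ∈ T) :
    ⁅unit i j, x⁆ ∈ lower (n := n) T :=
  Submodule.mem_iSup_of_mem i (Submodule.mem_iSup_of_mem j (Submodule.mem_iSup_of_mem h ⟨x, hx, rfl⟩))

theorem lower_le {T S : Submodule ℂ X}
    (h : ∀ i j : Fin n, j < i → ∀ x ∈ T, ⁅unit i j, x⁆ ∈ S) : lower (n := n) T ≤ S := by
  refine iSup_le fun i => iSup_le fun j => iSup_le fun hij => ?_
  rintro _ ⟨x, hx, rfl⟩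
  exact h i j hij x hx

theorem lower_mono {T S : Submodule ℂ X} (h : T ≤ S) : lower (n := n) T ≤ lower (n := n) S :=
  lower_le fun _ _ hij _ hx => lie_mem_lower hij (h hx)

theorem lower_sup (T S : Submodule ℂ X) :
    lower (n := n) (T ⊔ S) ≤ lower (n := n) T ⊔ lower (n := n) S := by
  refine lower_le fun i j hij x hx => ?_
  obtain ⟨y, hy, z, hz, rfl⟩ := Submodule.mem_sup.mp hx
  rw [lie_add]
  exact Submodule.add_mem_sup (lie_mem_lower hij hy) (lie_mem_lower hij hz)

instance finiteDimensional_lower (T : Submodule ℂ X) [FiniteDimensional ℂ T] :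
    FiniteDimensional ℂ (lower (n := n) T) := by
  unfold lower
  infer_instance

theorem nMinusMul_eq_lower : (nMinusMul (n := n) X).toSubmodule = lower (n := n) ⊤ := by
  apply le_antisymm
  · refine Submodule.span_le.mpr ?_
    rintro _ ⟨y, v, rfl⟩
    rw [eq_sum_unit (y : SL n), sum_lie]
    refine sum_mem fun i _ => ?_
    rw [sum_lie]
    refine sum_mem fun j _ => ?_
    rw [smul_lie]
    rcases lt_or_ge j i with h | h
    · exact Submodule.smul_mem _ _ (lie_mem_lower h trivial)
    · rw [y.2 i j h, zero_smul]; exact zero_mem _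
  · exact lower_le fun i j h x _ =>
      Submodule.subset_span ⟨⟨unit i j, unit_mem_nMinus h⟩, x, rfl⟩

theorem mem_nMinusMul {x : X} :
    x ∈ nMinusMul (n := n) X ↔ x ∈ lower (n := n) (⊤ : Submodule ℂ X) := by
  rw [← nMinusMul_eq_lower]; rfl

theorem lie_mem_of_unit {S T : Submodule ℂ X} (h : ∀ i j : Fin n, ∀ x ∈ S, ⁅unit i j, x⁆ ∈ T)
    (A : SL n) {x : X} (hx : x ∈ S) : ⁅A, x⁆ ∈ T := by
  rw [eq_sum_unit A, sum_lie]
  refine sum_mem fun i _ => ?_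
  rw [sum_lie]
  exact sum_mem fun j _ => by rw [smul_lie]; exact T.smul_mem _ (h i j x hx)

/-- The subspaces of `U(𝔫₋) F` spanned by the products of at most `k` factors. -/
def lowerIter (F : Submodule ℂ X) : ℕ → Submodule ℂ X
  | 0 => F
  | k + 1 => lowerIter F k ⊔ lower (n := n) (lowerIter F k)

/-- In x(fw) = [x,f]w + f(xw) the first term has one lowering factor fewer, so by induction any x ∈
𝔰𝔩ₙ costs at most one additional factor. This is the spanning half of the triangular decomposition.
-/
theorem lie_mem_lowerIter {F : Submodule ℂ X} (hF : IsBorelStable (n := n) F) (k : ℕ) :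
    ∀ i j : Fin n, ∀ x ∈ lowerIter (n := n) F k, ⁅unit i j, x⁆ ∈ lowerIter (n := n) F (k + 1) := by
  induction k with
  | zero =>
    intro i j x hx
    rcases lt_or_ge j i with h | h
    · exact le_sup_right (a := lowerIter (n := n) F 0) (lie_mem_lower h hx)
    · exact le_sup_left (b := lower (n := n) (lowerIter (n := n) F 0)) (hF i j h x hx)
  | succ k ih =>
    intro i j x hx
    obtain ⟨y, hy, z, hz, rfl⟩ := Submodule.mem_sup.mp hx
    have hle : lowerIter (n := n) F (k + 1) ≤ lowerIter (n := n) F (k + 2) := le_sup_left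
    rw [lie_add]
    refine add_mem (hle (ih i j y hy)) ?_
    refine lower_le (n := n) (S := (lowerIter (n := n) F (k + 2)).comap
      (LieModule.toEnd ℂ (SL n) X (unit i j))) (fun a b hab w hw => ?_) hz
    change ⁅unit i j, ⁅unit a b, w⁆⁆ ∈ lowerIter (n := n) F (k + 2)
    rw [leibniz_lie]
    refine add_mem (hle (lie_mem_of_unit ih _ hw)) ?_
    exact le_sup_right (a := lowerIter (n := n) F (k + 1)) (lie_mem_lower hab (ih i j w hw))

theorem lowerIter_le {F T : Submodule ℂ X} (hFT : F ≤ T) (hT : lower (n := n) T ≤ T) (k : ℕ) :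
    lowerIter (n := n) F k ≤ T := by
  induction k with
  | zero => exact hFT
  | succ k ih => exact sup_le ih ((lower_mono ih).trans hT)

/-- If `F` is stable under `𝔥 + 𝔫₊` then `U(𝔰𝔩ₙ) F = U(𝔫₋) F`. -/
theorem envAction_mem_of_borelStable {F T : Submodule ℂ X} (hF : IsBorelStable (n := n) F)
    (hFT : F ≤ T) (hT : lower (n := n) T ≤ T) (u : UniversalEnvelopingAlgebra ℂ (SL n)) {x : X}
    (hx : x ∈ F) : envAction (SL n) X u x ∈ T := by
  have hmono : Monotone (lowerIter (n := n) F) := monotone_nat_of_le_succ fun k => le_sup_left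
  have hU : ⨆ k, lowerIter (n := n) F k ≤ T := iSup_le (lowerIter_le hFT hT)
  refine hU (envAction_mem _ (fun A v hv => ?_) u x (Submodule.mem_iSup_of_mem 0 hx))
  have hdir : ∀ w : X, w ∈ ⨆ k, lowerIter (n := n) F k ↔ ∃ k, w ∈ lowerIter (n := n) F k :=
    fun w => Submodule.mem_iSup_of_directed _ hmono.directed_le
  rw [hdir] at hv ⊢
  obtain ⟨k, hk⟩ := hv
  exact ⟨k + 1, lie_mem_of_unit (lie_mem_lowerIter hF k) A hk⟩

theorem lower_sup_lower_top_le (F : Submodule ℂ X) :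
    lower (n := n) (F ⊔ lower (n := n) ⊤) ≤ F ⊔ lower (n := n) ⊤ :=
  (lower_mono le_top).trans le_sup_right

namespace WeightProjections

variable (P : WeightProjections n X)

theorem proj_mem_lower_top (ν : Weight n) {x : X} (hx : x ∈ lower (n := n) (⊤ : Submodule ℂ X)) :
    P.proj ν x ∈ lower (n := n) (⊤ : Submodule ℂ X) := by
  refine lower_le (n := n) (S := (lower (n := n) (⊤ : Submodule ℂ X)).comap (P.proj ν))
    (fun i j h x _ => ?_) hx
  rw [Submodule.mem_comap, P.proj_lie]
  exact lie_mem_lower h trivial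

/-- The sum of the weight spaces of height at most `a`. -/
def heightLE (a : ℝ) : Submodule ℂ X where
  carrier := {x | ∀ ν, a < height ν → P.proj ν x = 0}
  zero_mem' := fun _ _ => map_zero _
  add_mem' := fun hx hy ν h => by rw [map_add, hx ν h, hy ν h, add_zero]
  smul_mem' := fun c x hx ν h => by rw [map_smul, hx ν h, smul_zero]

theorem heightLE_mono {a b : ℝ} (h : a ≤ b) : P.heightLE a ≤ P.heightLE b :=
  fun _ hx ν hν => hx ν (h.trans_lt hν)

theorem lower_heightLE (a : ℝ) : lower (n := n) (P.heightLE a) ≤ P.heightLE (a - 1) := by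
  refine lower_le fun i j hij x hx ν hν => ?_
  rw [P.proj_lie, hx, lie_zero]
  rw [height_sub]
  have := height_root_le_neg_one hij
  linarith

theorem exists_mem_heightLE (x : X) : ∃ a, x ∈ P.heightLE a := by
  obtain ⟨s, hs⟩ := P.exists_sum x
  obtain ⟨a, ha⟩ := (s.image height).exists_le
  refine ⟨a, fun ν hν => ?_⟩
  rw [← hs, map_sum]
  refine Finset.sum_eq_zero fun μ hμ => P.proj_ne (P.proj_mem μ x) ?_
  rintro rfl
  exact absurd (ha _ (Finset.mem_image_of_mem _ hμ)) (not_le.mpr hν)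

theorem exists_le_heightLE (F : Submodule ℂ X) [FiniteDimensional ℂ F] :
    ∃ a, F ≤ P.heightLE a := by
  obtain ⟨t, rfl⟩ := (Module.Finite.iff_fg (N := F)).mp inferInstance
  choose a ha using P.exists_mem_heightLE
  obtain ⟨b, hb⟩ := (t.image a).exists_le
  exact ⟨b, Submodule.span_le.mpr fun x hx =>
    P.heightLE_mono (hb _ (Finset.mem_image_of_mem _ hx)) (ha x)⟩

/-- The sum of the weight spaces of height greater than `a`. -/
def heightGT (a : ℝ) : Submodule ℂ X where
  carrier := {x | ∀ ν, height ν ≤ a → P.proj ν x = 0}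
  zero_mem' := fun _ _ => map_zero _
  add_mem' := fun hx hy ν h => by rw [map_add, hx ν h, hy ν h, add_zero]
  smul_mem' := fun c x hx ν h => by rw [map_smul, hx ν h, smul_zero]

theorem isBorelStable_heightGT (a : ℝ) : IsBorelStable (n := n) (P.heightGT a) := by
  intro i j hij x hx ν hν
  rw [P.proj_lie, hx, lie_zero]
  rw [height_sub]
  have := height_root_nonneg hij
  linarith

theorem lie_mem_heightGT {μ : Weight n} {x : X} (hx : x ∈ weightSpace X μ) {i j : Fin n}
    (h : i < j) : ⁅unit i j, x⁆ ∈ P.heightGT (height μ) := by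
  intro ν hν
  refine P.proj_ne (lie_unit_mem_weightSpace hx i j) ?_
  rintro rfl
  rw [height_add] at hν
  have := height_root_ge_one h
  linarith

end WeightProjections

end WeightModules

/-! ### Finite-dimensional Borel-stable subspaces and weight spaces. -/

section LocalFiniteness

variable {n : ℕ} {X : Type*} [AddCommGroup X] [Module ℂ X]
  [LieRingModule (SL n) X] [LieModule ℂ (SL n) X]

theorem exists_borelStable_of_mem_weightSpace (hX : IsObject n X) {μ : Weight n} {x : X}
    (hx : x ∈ weightSpace X μ) :
    ∃ F : Submodule ℂ X, FiniteDimensional ℂ F ∧ IsBorelStable (n := n) F ∧ x ∈ F := by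
  let N := LinearMap.range ((LinearMap.applyₗ x).comp (envAction (nPlus n) X).toLinearMap)
  have hN : ∀ (e : nPlus n), ∀ w ∈ N, ⁅e, w⁆ ∈ N := by
    rintro e _ ⟨u, rfl⟩
    refine ⟨UniversalEnvelopingAlgebra.ι ℂ e * u, ?_⟩
    change envAction (nPlus n) X (UniversalEnvelopingAlgebra.ι ℂ e * u) x = _
    rw [map_mul, Module.End.mul_apply, envAction_ι]
    rfl
  have hxN : x ∈ N := ⟨1, by
    change envAction (nPlus n) X 1 x = x
    rw [map_one, Module.End.one_apply]⟩
  have hup : ∀ i j : Fin n, i < j → ∀ w ∈ N, ⁅unit i j, w⁆ ∈ N := fun i j h w hw =>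
    hN ⟨unit i j, unit_mem_nPlus h⟩ w hw
  -- `N` = U(𝔫₊)x is finite-dimensional but must also be stable under 𝔥. The vectors of `N` that 𝔥
  -- keeps in `N` form an 𝔫₊-stable subspace containing x, hence all of `N`.
  let K : Submodule ℂ X :=
    { carrier := {w | w ∈ N ∧ ∀ i : Fin n, ⁅unit i i, w⁆ ∈ N}
      zero_mem' := ⟨zero_mem _, fun i => by rw [lie_zero]; exact zero_mem _⟩
      add_mem' := fun ha hb => ⟨add_mem ha.1 hb.1, fun i => by
        rw [lie_add]; exact add_mem (ha.2 i) (hb.2 i)⟩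
      smul_mem' := fun c w hw => ⟨N.smul_mem c hw.1, fun i => by
        rw [lie_smul]; exact N.smul_mem c (hw.2 i)⟩ }
  have hK : ∀ (e : nPlus n), ∀ w ∈ K, ⁅e, w⁆ ∈ K := by
    intro e w hw
    refine ⟨hN e w hw.1, fun i => ?_⟩
    change ⁅unit i i, ⁅(e : SL n), w⁆⁆ ∈ N
    rw [leibniz_lie]
    refine add_mem ?_ (hN e _ (hw.2 i))
    rw [eq_sum_unit (e : SL n)]
    simp only [lie_sum, sum_lie]
    refine sum_mem fun a _ => sum_mem fun b _ => ?_
    rcases lt_or_ge a b with h | h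
    · rw [lie_smul, smul_lie, ← coe_diagUnit, cartan_lie_unit, smul_lie]
      exact N.smul_mem _ (N.smul_mem _ (hup a b h w hw.1))
    · rw [e.2 a b h, zero_smul, lie_zero, zero_lie]
      exact zero_mem _
  have hxK : x ∈ K := ⟨hxN, fun i => by
    have : ⁅unit i i, x⁆ = μ (diagUnit i) • x := mem_weightSpace.mp hx (diagUnit i)
    rw [this]
    exact N.smul_mem _ hxN⟩
  have hNK : ∀ w ∈ N, w ∈ K := by
    rintro _ ⟨u, rfl⟩
    exact envAction_mem K hK u x hxK
  refine ⟨N, hX.locallyFinite x, fun i j hij w hw => ?_, hxN⟩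
  rcases hij.lt_or_eq with h | rfl
  · exact hup i j h w hw
  · exact (hNK w hw).2 i

omit [LieModule ℂ (SL n) X] in
theorem IsBorelStable.sup {F G : Submodule ℂ X} (hF : IsBorelStable (n := n) F)
    (hG : IsBorelStable (n := n) G) : IsBorelStable (n := n) (F ⊔ G) := by
  intro i j hij x hx
  obtain ⟨y, hy, z, hz, rfl⟩ := Submodule.mem_sup.mp hx
  rw [lie_add]
  exact Submodule.add_mem_sup (hF i j hij y hy) (hG i j hij z hz)

omit [LieModule ℂ (SL n) X] in
theorem isBorelStable_bot : IsBorelStable (n := n) (⊥ : Submodule ℂ X) := by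
  intro i j _ x hx
  rw [Submodule.mem_bot] at hx ⊢
  rw [hx, lie_zero]

theorem exists_borelStable (hX : IsObject n X) (x : X) :
    ∃ F : Submodule ℂ X, FiniteDimensional ℂ F ∧ IsBorelStable (n := n) F ∧ x ∈ F := by
  obtain ⟨P⟩ := hX.nonempty_weightProjections
  induction x using P.induction with
  | mem μ x hx => exact exists_borelStable_of_mem_weightSpace hX hx
  | zero => exact ⟨⊥, inferInstance, isBorelStable_bot, zero_mem _⟩
  | add x y hx hy =>
    obtain ⟨F, _, hF, hxF⟩ := hx
    obtain ⟨G, _, hG, hyG⟩ := hy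
    exact ⟨F ⊔ G, inferInstance, hF.sup hG, Submodule.add_mem_sup hxF hyG⟩

theorem exists_borelStable_finset (hX : IsObject n X) (s : Finset X) :
    ∃ F : Submodule ℂ X, FiniteDimensional ℂ F ∧ IsBorelStable (n := n) F ∧ ∀ x ∈ s, x ∈ F := by
  classical
  induction s using Finset.induction_on with
  | empty => exact ⟨⊥, inferInstance, isBorelStable_bot, by simp⟩
  | insert x s _ ih =>
    obtain ⟨F, _, hF, hs⟩ := ih
    obtain ⟨G, _, hG, hx⟩ := exists_borelStable hX x
    refine ⟨F ⊔ G, inferInstance, hF.sup hG, fun y hy => ?_⟩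
    rcases Finset.mem_insert.mp hy with rfl | hy
    · exact Submodule.mem_sup_right hx
    · exact Submodule.mem_sup_left (hs y hy)

/-- A module in `𝒪` is generated by a finite-dimensional `𝔥 + 𝔫₊`-stable subspace. -/
theorem exists_borelStable_generating (hX : IsObject n X) :
    ∃ F : Submodule ℂ X, FiniteDimensional ℂ F ∧ IsBorelStable (n := n) F ∧
      ∀ T : Submodule ℂ X, F ≤ T → lower (n := n) T ≤ T → T = ⊤ := by
  let := envModule (SL n) X
  obtain ⟨s, hs⟩ := hX.finite.fg_top
  obtain ⟨F, hfin, hF, hsF⟩ := exists_borelStable_finset hX s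
  refine ⟨F, hfin, hF, fun T hFT hT => ?_⟩
  rw [eq_top_iff]
  rintro x -
  have hx : x ∈ Submodule.span (UniversalEnvelopingAlgebra ℂ (SL n)) (s : Set X) := by
    rw [hs]; trivial
  rw [Submodule.mem_span_finset] at hx
  obtain ⟨f, -, rfl⟩ := hx
  exact sum_mem fun y hy => envAction_mem_of_borelStable hF hFT hT (f y) (hsF y hy)

/-- Iterating X = F + 𝔫₋X, with F finite-dimensional of height at most a, gives X = S + (heights ≤ a
− k) with S finite-dimensional. Once a − k is below the height of μ, X_μ lies in the projection of
S. -/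
theorem finiteDimensional_weightSpace (hX : IsObject n X) (μ : Weight n) :
    FiniteDimensional ℂ (weightSpace X μ) := by
  obtain ⟨P⟩ := hX.nonempty_weightProjections
  obtain ⟨F, _, hF, hgen⟩ := exists_borelStable_generating hX
  obtain ⟨a, ha⟩ := P.exists_le_heightLE F
  have htop : P.heightLE a = ⊤ :=
    hgen _ ha ((P.lower_heightLE a).trans (P.heightLE_mono (by linarith)))
  have hlow : F ⊔ lower (n := n) ⊤ = ⊤ := hgen _ le_sup_left (lower_sup_lower_top_le F)
  have key : ∀ k : ℕ, ∃ S : Submodule ℂ X, FiniteDimensional ℂ S ∧ S ⊔ P.heightLE (a - k) = ⊤ := by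
    intro k
    induction k with
    | zero => exact ⟨⊥, inferInstance, by simp [htop]⟩
    | succ k ih =>
      obtain ⟨S, _, hS⟩ := ih
      refine ⟨F ⊔ lower (n := n) S, inferInstance, ?_⟩
      rw [eq_top_iff, ← hlow, ← hS, sup_assoc]
      refine sup_le_sup_left ((lower_sup _ _).trans (sup_le_sup_left ?_ _)) _
      refine (P.lower_heightLE _).trans (P.heightLE_mono ?_)
      push_cast
      linarith
  obtain ⟨k, hk⟩ := exists_nat_gt (a - height μ)
  obtain ⟨S, _, hS⟩ := key k
  refine Submodule.finiteDimensional_of_le (S₂ := S.map (P.proj μ)) fun x hx => ?_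
  have hx' : x ∈ S ⊔ P.heightLE (a - k) := by rw [hS]; trivial
  obtain ⟨y, hy, z, hz, rfl⟩ := Submodule.mem_sup.mp hx'
  refine ⟨y, hy, ?_⟩
  rw [← P.proj_same hx, map_add, hz μ (by linarith), add_zero]

end LocalFiniteness

/-! ### Fitting decomposition and injectivity on finite-dimensional spaces. -/

section LinearAlgebra

/-- Fitting's lemma for an ideal `I` of a commutative algebra acting on a finite-dimensional space:
some `z ∈ I` is such that `1 - z` maps everything into the subspace killed by a power of `I`. -/
theorem exists_fitting {R V : Type*} [CommRing R] [Algebra ℂ R] [AddCommGroup V] [Module ℂ V]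
    [FiniteDimensional ℂ V] (φ : R →ₐ[ℂ] Module.End ℂ V) (I : Ideal R) :
    ∃ z ∈ I, ∃ N : ℕ, ∀ w ∈ I ^ N, ∀ v, φ w (v - φ z v) = 0 := by
  let A := R ⧸ RingHom.ker φ
  have : Module.Finite ℂ A :=
    Module.Finite.of_injective (Ideal.kerLiftAlg φ).toLinearMap (Ideal.kerLiftAlg_injective φ)
  have : IsArtinianRing A := IsArtinianRing.of_finite ℂ A
  let q : R →+* A := Ideal.Quotient.mk _
  have hq : Function.Surjective q := Ideal.Quotient.mk_surjective
  obtain ⟨N, hN⟩ := IsArtinian.monotone_stabilizes (R := A) (M := A)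
    ⟨fun k => OrderDual.toDual (I.map q ^ k), fun a b h => Ideal.pow_le_pow_right h⟩
  replace hN : ∀ m, N ≤ m → I.map q ^ N = I.map q ^ m := hN
  -- The stable power is an idempotent ideal, hence generated by an idempotent. The exponent `N + 1`
  -- ensures that its lift `z` lies in `I` even when `N = 0`.
  have hidem : IsIdempotentElem (I.map q ^ (N + 1)) := by
    rw [IsIdempotentElem, ← pow_add, ← hN (N + 1) (by omega), ← hN _ (by omega)]
  obtain ⟨e, he, hspan⟩ := (Ideal.isIdempotentElem_iff_of_fg _
    (IsNoetherian.noetherian (I.map q ^ (N + 1)))).mp hidem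
  rw [← Ideal.map_pow] at hspan
  have heI : e ∈ (I ^ (N + 1)).map q := by rw [hspan]; exact Submodule.mem_span_singleton_self e
  obtain ⟨z, hz, rfl⟩ := (Ideal.mem_map_iff_of_surjective q hq).mp heI
  refine ⟨z, Ideal.pow_le_self (Nat.succ_ne_zero N) hz, N + 1, fun w hw v => ?_⟩
  have hw' : q w ∈ Ideal.span {q z} := by
    have := Ideal.mem_map_of_mem q hw
    rwa [hspan] at this
  obtain ⟨a, ha⟩ := Ideal.mem_span_singleton.mp hw'
  have hker : w - w * z ∈ RingHom.ker φ := by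
    rw [← Ideal.Quotient.eq_zero_iff_mem]
    change q (w - w * z) = 0
    rw [map_sub, map_mul, ha, mul_right_comm, he.eq, sub_self]
  have h0 : φ (w - w * z) v = 0 := by rw [(RingHom.mem_ker).mp hker]; rfl
  rwa [map_sub, map_mul, LinearMap.sub_apply, Module.End.mul_apply, ← map_sub] at h0

variable {V : Type*} [AddCommGroup V] [Module ℂ V]

theorem le_map_of_injective {D : Module.End ℂ V} {Q : Submodule ℂ V} [FiniteDimensional ℂ Q]
    (hD : ∀ x ∈ Q, D x ∈ Q) (hinj : ∀ x ∈ Q, D x = 0 → x = 0) : Q ≤ Q.map D := by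
  have h : Function.Injective (D.restrict hD) := by
    rw [injective_iff_map_eq_zero]
    exact fun x hx => Subtype.ext (hinj x x.2 (congrArg Subtype.val hx))
  intro x hx
  obtain ⟨y, hy⟩ := LinearMap.injective_iff_surjective.mp h ⟨x, hx⟩
  exact ⟨y, y.2, congrArg Subtype.val hy⟩

/-- By dimension the inclusion Q ≤ DQ is an equality, so D restricts to a surjective, hence
injective, endomorphism of Q. -/
theorem eq_zero_of_pow_apply_eq_zero {D : Module.End ℂ V} {Q : Submodule ℂ V}
    [FiniteDimensional ℂ Q] (hQ : Q ≤ Q.map D) {k : ℕ} {v : V} (hv : v ∈ Q)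
    (h : (D ^ k) v = 0) : v = 0 := by
  have heq : Q = Q.map D := Submodule.eq_of_le_of_finrank_le hQ (Submodule.finrank_map_le D Q)
  have hD : ∀ x ∈ Q, D x ∈ Q := fun x hx => by
    have := Submodule.mem_map_of_mem (f := D) hx
    rwa [← heq] at this
  have hsurj : Function.Surjective (D.restrict hD) := by
    rintro ⟨x, hx⟩
    obtain ⟨y, hy, hyx⟩ := hQ hx
    exact ⟨⟨y, hy⟩, Subtype.ext hyx⟩
  have hinj := LinearMap.injective_iff_surjective.mpr hsurj
  induction k generalizing v with
  | zero => simpa using h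
  | succ k ih =>
    rw [pow_succ, Module.End.mul_apply] at h
    have h0 := ih (hD v hv) h
    exact congrArg Subtype.val (hinj (a₁ := ⟨v, hv⟩) (a₂ := 0) (Subtype.ext (by simpa using h0)))

end LinearAlgebra

/-! ### The action of the center on weight vectors. -/

section Center

variable {n : ℕ} {X : Type*} [AddCommGroup X] [Module ℂ X]
  [LieRingModule (SL n) X] [LieModule ℂ (SL n) X]

theorem center_lie (z : Center n) (A : SL n) (v : X) :
    envAction (SL n) X z ⁅A, v⁆ = ⁅A, envAction (SL n) X z v⁆ := by
  rw [← envAction_ι A v, ← envAction_ι A, ← Module.End.mul_apply, ← map_mul,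
    ← Subalgebra.mem_center_iff.mp z.2, map_mul, Module.End.mul_apply]

theorem center_mem_weightSpace (z : Center n) {μ : Weight n} {x : X} (hx : x ∈ weightSpace X μ) :
    envAction (SL n) X z x ∈ weightSpace X μ := by
  rw [mem_weightSpace] at hx ⊢
  intro h
  have hh : ⁅(h : SL n), x⁆ = μ h • x := hx h
  change ⁅(h : SL n), envAction (SL n) X z x⁆ = _
  rw [← center_lie, hh, map_smul]

/-- The action of the center on a weight space. -/
def centerAction (X : Type*) [AddCommGroup X] [Module ℂ X]
    [LieRingModule (SL n) X] [LieModule ℂ (SL n) X] (μ : Weight n) :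
    Center n →ₐ[ℂ] Module.End ℂ (weightSpace X μ) where
  toFun z := (envAction (SL n) X z).restrict fun _ hx => center_mem_weightSpace z hx
  map_one' := by ext x; simp
  map_mul' z w := by ext x; simp
  map_zero' := by ext x; simp
  map_add' z w := by ext x; simp
  commutes' c := by ext x; simp

theorem lie_nPlus_mem {S : Submodule ℂ X} {x : X}
    (h : ∀ i j : Fin n, i < j → ⁅unit i j, x⁆ ∈ S) (e : nPlus n) : ⁅(e : SL n), x⁆ ∈ S := by
  rw [eq_sum_unit (e : SL n), sum_lie]
  refine sum_mem fun i _ => ?_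
  rw [sum_lie]
  refine sum_mem fun j _ => ?_
  rw [smul_lie]
  rcases lt_or_ge i j with hij | hij
  · exact S.smul_mem _ (h i j hij)
  · rw [e.2 i j hij, zero_smul]; exact zero_mem _

theorem envAction_cartan_sub {μ : Weight n} {x : X} (hx : x ∈ weightSpace X μ) (h : cartan n) :
    envAction (SL n) X (UniversalEnvelopingAlgebra.ι ℂ (h : SL n) - algebraMap ℂ _ (μ h)) x = 0 := by
  have hh : ⁅(h : SL n), x⁆ = μ h • x := mem_weightSpace.mp hx h
  rw [map_sub, LinearMap.sub_apply, envAction_ι, AlgHom.commutes, Module.algebraMap_end_apply, hh,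
    sub_self]

theorem envAction_vermaIdeal_mem {μ : Weight n} {x : X} (hx : x ∈ weightSpace X μ)
    {T : Submodule ℂ X}
    (hT : ∀ (a : UniversalEnvelopingAlgebra ℂ (SL n)) (e : nPlus n),
      envAction (SL n) X a ⁅(e : SL n), x⁆ ∈ T)
    {u : UniversalEnvelopingAlgebra ℂ (SL n)} (hu : u ∈ vermaIdeal μ) :
    envAction (SL n) X u x ∈ T := by
  -- The additional left factor `a` absorbs the coefficients of the left ideal in the induction.
  have key : ∀ a, envAction (SL n) X a (envAction (SL n) X u x) ∈ T := by
    induction hu using Submodule.span_induction with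
    | mem u hu =>
      intro a
      rcases hu with ⟨e, rfl⟩ | ⟨h, rfl⟩
      · dsimp only
        rw [envAction_ι]
        exact hT a e
      · dsimp only
        rw [envAction_cartan_sub hx, map_zero]
        exact zero_mem _
    | zero => intro a; rw [map_zero, LinearMap.zero_apply, map_zero]; exact zero_mem _
    | add u w _ _ hu hw =>
      intro a
      rw [map_add, LinearMap.add_apply, map_add]
      exact add_mem (hu a) (hw a)
    | smul b u _ hu =>
      intro a
      have := hu (a * b)
      rw [map_mul, Module.End.mul_apply] at this
      rwa [smul_eq_mul, map_mul, Module.End.mul_apply]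
  simpa using key 1

/-- `Z_μ` maps the weight space `X_μ` into `𝔫₋ X`. -/
theorem infCharKer_mem_lower_top (P : WeightProjections n X) {μ : Weight n} {z : Center n}
    (hz : z ∈ infCharKer μ) {x : X} (hx : x ∈ weightSpace X μ) :
    envAction (SL n) X z x ∈ lower (n := n) (⊤ : Submodule ℂ X) := by
  -- 𝔫₊x lies in the Borel-stable sum of weight spaces above the height of μ, and U(𝔰𝔩ₙ) carries
  -- that sum into itself plus 𝔫₋X. Projection to weight μ then kills the first summand.
  have hmem : envAction (SL n) X z x ∈ P.heightGT (height μ) ⊔ lower (n := n) ⊤ :=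
    envAction_vermaIdeal_mem hx (fun a e =>
      envAction_mem_of_borelStable (P.isBorelStable_heightGT _) le_sup_left
        (lower_sup_lower_top_le _) a (lie_nPlus_mem (fun i j h => P.lie_mem_heightGT hx h) e))
      (mem_infCharKer.mp hz)
  obtain ⟨y, hy, w, hw, hyw⟩ := Submodule.mem_sup.mp hmem
  rw [← P.proj_same (center_mem_weightSpace z hx), ← hyw, map_add, hy μ le_rfl, zero_add]
  exact P.proj_mem_lower_top μ hw

theorem casimirScalar_eq_of_singular {μ ν : Weight n} {w : X} (hw : w ∈ weightSpace X ν)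
    (hw0 : w ≠ 0) (hsing : ∀ i j : Fin n, i < j → ⁅unit i j, w⁆ = 0)
    (hD : envAction (SL n) X (shiftedCasimir μ) w = 0) : casimirScalar ν = casimirScalar μ := by
  have h : envAction (SL n) X (casimir n - algebraMap ℂ _ (casimirScalar ν)) w ∈
      (⊥ : Submodule ℂ X) :=
    envAction_vermaIdeal_mem hw (fun a e => by
      have : ⁅(e : SL n), w⁆ ∈ (⊥ : Submodule ℂ X) :=
        lie_nPlus_mem (fun i j hij => (Submodule.mem_bot ℂ).mpr (hsing i j hij)) e
      rw [(Submodule.mem_bot ℂ).mp this, map_zero]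
      exact zero_mem _) (casimir_sub_mem_vermaIdeal ν)
  rw [Submodule.mem_bot, map_sub, LinearMap.sub_apply, AlgHom.commutes,
    Module.algebraMap_end_apply, sub_eq_zero] at h
  rw [coe_shiftedCasimir, map_sub, LinearMap.sub_apply, AlgHom.commutes,
    Module.algebraMap_end_apply, sub_eq_zero, h] at hD
  exact smul_left_injective ℂ hw0 hD

/-- A nonzero kernel vector can be raised forever: raising commutes with D, and a singular vector
met on the way would have weight μ by the Casimir comparison, against its height. The vectors stay
in a finite-dimensional F, whose heights are bounded. -/
theorem shiftedCasimir_injOn (hX : IsObject n X) {μ ν : Weight n}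
    (hμ : IsDominantIntegral (μ + rho n)) (hν : ν - μ ∈ positiveCone n)
    (hlt : height μ < height ν) {x : X} (hx : x ∈ weightSpace X ν)
    (hD : envAction (SL n) X (shiftedCasimir μ) x = 0) : x = 0 := by
  by_contra hx0
  obtain ⟨P⟩ := hX.nonempty_weightProjections
  obtain ⟨F, _, hF, hxF⟩ := exists_borelStable hX x
  obtain ⟨a, ha⟩ := P.exists_le_heightLE F
  have key : ∀ k : ℕ, ∃ η : Weight n, height ν + k ≤ height η ∧ η - μ ∈ positiveCone n ∧
      ∃ w ∈ F, w ∈ weightSpace X η ∧ w ≠ 0 ∧ envAction (SL n) X (shiftedCasimir μ) w = 0 := by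
    intro k
    induction k with
    | zero => exact ⟨ν, by simp, hν, x, hxF, hx, hx0, hD⟩
    | succ k ih =>
      obtain ⟨η, hη, hpos, w, hwF, hw, hw0, hDw⟩ := ih
      have hns : ¬ ∀ i j : Fin n, i < j → ⁅unit i j, w⁆ = 0 := by
        intro hsing
        have h0 := eq_zero_of_casimirScalar_eq hμ hpos (by
          rw [add_sub_cancel]; exact casimirScalar_eq_of_singular hw hw0 hsing hDw)
        rw [sub_eq_zero.mp h0] at hη
        have : (0 : ℝ) ≤ k := Nat.cast_nonneg k
        linarith
      push Not at hns
      obtain ⟨i, j, hij, hne⟩ := hns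
      refine ⟨η + root i j, ?_, ?_, _, hF i j hij.le w hwF, lie_unit_mem_weightSpace hw i j, hne, ?_⟩
      · have := height_root_ge_one hij
        rw [height_add]
        push_cast
        linarith
      · rw [add_sub_right_comm]
        exact add_mem hpos (root_mem_positiveCone hij)
      · rw [center_lie, hDw, lie_zero]
  obtain ⟨k, hk⟩ := exists_nat_gt (a - height ν)
  obtain ⟨η, hη, -, w, hwF, hw, hw0, -⟩ := key k
  refine hw0 ?_
  rw [← P.proj_same hw]
  exact ha hwF η (by linarith)

end Center

/-! ### Injectivity and surjectivity of the natural map. -/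

section Main

variable {n : ℕ} {X : Type*} [AddCommGroup X] [Module ℂ X]
  [LieRingModule (SL n) X] [LieModule ℂ (SL n) X]

/-- The part of `X_μ` which comes from the weight spaces of weight `μ + α`, `α` a positive root. -/
def lowerWeight (X : Type*) [AddCommGroup X] [Module ℂ X]
    [LieRingModule (SL n) X] [LieModule ℂ (SL n) X] (μ : Weight n) : Submodule ℂ X :=
  ⨆ (i : Fin n) (j : Fin n) (_ : j < i),
    (weightSpace X (μ - root i j)).map (LieModule.toEnd ℂ (SL n) X (unit i j))

theorem mem_lowerWeight (P : WeightProjections n X) {μ : Weight n} {x : X}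
    (hx : x ∈ weightSpace X μ) (hlow : x ∈ lower (n := n) (⊤ : Submodule ℂ X)) :
    x ∈ lowerWeight X μ := by
  rw [← P.proj_same hx]
  refine lower_le (n := n) (S := (lowerWeight X μ).comap (P.proj μ)) (fun i j h y _ => ?_) hlow
  rw [Submodule.mem_comap, P.proj_lie]
  exact Submodule.mem_iSup_of_mem i (Submodule.mem_iSup_of_mem j (Submodule.mem_iSup_of_mem h
    ⟨_, P.proj_mem _ y, rfl⟩))

/-- For j < i the weight μ − (εᵢ − εⱼ) is μ plus a positive root, so D is injective, hence
surjective, on that finite-dimensional weight space. A preimage there can be moved past the lowering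
operator. -/
theorem lowerWeight_le_map (hX : IsObject n X) {μ : Weight n}
    (hμ : IsDominantIntegral (μ + rho n)) :
    lowerWeight X μ ≤ (lowerWeight X μ).map (envAction (SL n) X (shiftedCasimir μ)) := by
  refine iSup_le fun i => iSup_le fun j => iSup_le fun h => ?_
  rintro _ ⟨x, hx, rfl⟩
  have hroot : -root i j = root j i := by rw [root, root, neg_sub]
  have hfin := finiteDimensional_weightSpace hX (μ - root i j)
  obtain ⟨y, hy, rfl⟩ := le_map_of_injective
    (fun _ hx => center_mem_weightSpace (shiftedCasimir μ) hx)
    (fun y hy hD => shiftedCasimir_injOn hX hμ (by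
        rw [sub_sub_cancel_left, hroot]; exact root_mem_positiveCone h) (by
        have := height_root_le_neg_one h
        rw [height_sub]; linarith) hy hD) hx
  refine ⟨⁅unit i j, y⁆, ?_, center_lie _ _ _⟩
  exact Submodule.mem_iSup_of_mem i (Submodule.mem_iSup_of_mem j (Submodule.mem_iSup_of_mem h
    ⟨y, hy, rfl⟩))

theorem finiteDimensional_lowerWeight (hX : IsObject n X) (μ : Weight n) :
    FiniteDimensional ℂ (lowerWeight X μ) := by
  have := fun ν => finiteDimensional_weightSpace hX ν
  unfold lowerWeight
  infer_instance

theorem coe_naturalMap (wt : Weight n) (v : weightSpace (block X wt) wt) :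
    (naturalMap X wt v : H0 n X) =
      LieSubmodule.Quotient.mk (N := nMinusMul (n := n) X) ((v : block X wt) : X) := rfl

theorem naturalMap_injective (hX : IsObject n X) {wt : Weight n}
    (hwt : IsDominantIntegral (wt + rho n)) : Function.Injective (naturalMap X wt) := by
  rw [injective_iff_map_eq_zero]
  rintro ⟨⟨v, k, hk⟩, hv⟩ h0
  obtain ⟨P⟩ := hX.nonempty_weightProjections
  have hlow : v ∈ lower (n := n) (⊤ : Submodule ℂ X) := by
    rw [← mem_nMinusMul, ← LieSubmodule.Quotient.mk_eq_zero']
    exact congrArg Subtype.val h0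
  have hvX : v ∈ weightSpace X wt := by
    rw [mem_weightSpace] at hv ⊢
    exact fun h => congrArg Subtype.val (hv h)
  have := finiteDimensional_lowerWeight hX wt
  have hzero : v = 0 := eq_zero_of_pow_apply_eq_zero (lowerWeight_le_map hX hwt) (k := k)
    (mem_lowerWeight P hvX hlow) (by
      have := hk _ (Ideal.pow_mem_pow (shiftedCasimir_mem_infCharKer wt) k)
      rwa [SubmonoidClass.coe_pow, map_pow] at this)
  subst hzero
  rfl

/-- Since 𝔫₋X is graded by weights, (ν(h) − μ(h))x_ν ∈ 𝔫₋X for every h, and some h separates ν ≠ μ.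
Thus a weight vector of the quotient lifts to one of the same weight. -/
theorem sub_proj_mem_lower_top (P : WeightProjections n X) {μ : Weight n} {x : X}
    (hx : ∀ h : cartan n, ⁅(h : SL n), x⁆ - μ h • x ∈ lower (n := n) (⊤ : Submodule ℂ X)) :
    x - P.proj μ x ∈ lower (n := n) (⊤ : Submodule ℂ X) := by
  classical
  have hcart : ∀ (ν : Weight n) (h : cartan n) (y : X),
      P.proj ν ⁅(h : SL n), y⁆ = ν h • P.proj ν y := by
    intro ν h y
    induction y using P.induction with
    | mem η y hy =>
      have hh : ⁅(h : SL n), y⁆ = η h • y := mem_weightSpace.mp hy h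
      rw [hh, map_smul]
      by_cases hne : η = ν
      · rw [hne]
      · rw [P.proj_ne hy hne, smul_zero, smul_zero]
    | zero => simp
    | add y z hy hz => rw [lie_add, map_add, map_add, smul_add, hy, hz]
  have hne : ∀ ν : Weight n, ν ≠ μ → P.proj ν x ∈ lower (n := n) (⊤ : Submodule ℂ X) := by
    intro ν hν
    obtain ⟨h, hh⟩ : ∃ h, ν h ≠ μ h := by
      by_contra hcon
      push Not at hcon
      exact hν (LinearMap.ext hcon)
    have hp := P.proj_mem_lower_top ν (hx h)
    rw [map_sub, hcart, map_smul, ← sub_smul] at hp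
    have := Submodule.smul_mem _ (ν h - μ h)⁻¹ hp
    rwa [smul_smul, inv_mul_cancel₀ (sub_ne_zero.mpr hh), one_smul] at this
  obtain ⟨s, hs⟩ := P.exists_sum x
  have hs' : P.proj μ x = ∑ ν ∈ s, P.proj μ (P.proj ν x) := by rw [← map_sum, hs]
  have hsub : x - P.proj μ x = ∑ ν ∈ s, (P.proj ν x - P.proj μ (P.proj ν x)) := by
    rw [Finset.sum_sub_distrib, hs, ← hs']
  rw [hsub]
  refine sum_mem fun ν _ => ?_
  by_cases hν : ν = μ
  · rw [hν, P.proj_same (P.proj_mem μ x), sub_self]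
    exact zero_mem _
  · rw [P.proj_ne (P.proj_mem ν x) hν, sub_zero]
    exact hne ν hν

theorem naturalMap_surjective (hX : IsObject n X) (wt : Weight n) :
    Function.Surjective (naturalMap X wt) := by
  rintro ⟨q, hq⟩
  obtain ⟨x, rfl⟩ := LieSubmodule.Quotient.surjective_mk' (nMinusMul (n := n) X) q
  obtain ⟨P⟩ := hX.nonempty_weightProjections
  have hx : x - P.proj wt x ∈ lower (n := n) (⊤ : Submodule ℂ X) := by
    refine sub_proj_mem_lower_top P fun h => ?_
    rw [← mem_nMinusMul, ← LieSubmodule.Quotient.mk_eq_zero']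
    have hh := mem_weightSpace.mp hq h
    rw [← LieModuleHom.map_lie, ← map_smul, ← sub_eq_zero, ← map_sub] at hh
    exact hh
  have := finiteDimensional_weightSpace hX wt
  let y : weightSpace X wt := ⟨P.proj wt x, P.proj_mem wt x⟩
  obtain ⟨z, hz, N, hN⟩ := exists_fitting (centerAction X wt) (infCharKer wt)
  -- The correction zy lies in 𝔫₋X, so `v` has the class of `y`, while the Fitting property puts it
  -- in the block.
  let v : weightSpace X wt := y - centerAction X wt z y
  have hblock : (v : X) ∈ block X wt := ⟨N, fun w hw => congrArg Subtype.val (hN w hw y)⟩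
  refine ⟨⟨⟨v, hblock⟩, mem_weightSpace.mpr fun h => Subtype.ext (mem_weightSpace.mp v.2 h)⟩,
    Subtype.ext ?_⟩
  rw [coe_naturalMap]
  change LieSubmodule.Quotient.mk' (nMinusMul (n := n) X) (v : X) =
    LieSubmodule.Quotient.mk' (nMinusMul (n := n) X) x
  rw [← sub_eq_zero, ← map_sub]
  refine LieSubmodule.Quotient.mk_eq_zero'.mpr (mem_nMinusMul.mpr ?_)
  have hv : (v : X) - x = -((x - P.proj wt x) + envAction (SL n) X z (P.proj wt x)) := by
    change P.proj wt x - envAction (SL n) X z (P.proj wt x) - x = _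
    abel
  rw [hv]
  exact neg_mem (add_mem hx (infCharKer_mem_lower_top P hz (P.proj_mem wt x)))

end Main

end CategoryO

end

theorem mainTheorem2 (n : ℕ) (wt : CategoryO.Weight n)
    (hwt : CategoryO.IsDominantIntegral (wt + CategoryO.rho n))
    (X : Type*) [AddCommGroup X] [Module ℂ X]
    [LieRingModule (CategoryO.SL n) X] [LieModule ℂ (CategoryO.SL n) X]
    (hX : CategoryO.IsObject n X) :
    Function.Bijective (CategoryO.naturalMap X wt) :=
  ⟨CategoryO.naturalMap_injective hX hwt, CategoryO.naturalMap_surjective hX wt⟩
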